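/- Let $K$ be a compact Hausdorff space and let $C(K)$ be the Banach lattice of continuous functions $K\to\mathbb{R}$, with the supremum norm and the pointwise order. Say that a linear subspace $E\subseteq C(K)$ does stable phase retrieval (is SPR) if there is a constant $C>0$ such that $$\inf_{\lambda\in\mathbb{R},\,|\lambda|=1}\|f-\lambda g\|\le C\,\big\||f|-|g|\big\|\qquad\text{for all } f,g\in E.$$ Let $K'$, the Cantor–Bendixson derivative of $K$, be the set of all non-isolated points of $K$. Then $C(K)$ contains a closed infinite-dimensional SPR subspace if and only if $K'$ is infinite. -/

import Mathlib

open Topology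

section Definitions

/-- The supremum norm of `C(K, ℝ)` is a lattice norm, so that `C(K, ℝ)` is a Banach lattice. -/
instance continuousMapHasSolidNorm {K : Type*} [TopologicalSpace K] [CompactSpace K] :
    HasSolidNorm C(K, ℝ) where
  solid f g h := (ContinuousMap.norm_le f (norm_nonneg g)).2 fun x => by
    have hx : |f x| ≤ |g x| := by simpa using h x
    exact hx.trans (g.norm_coe_le_norm x)

/-- `E` does `C`-stable phase retrieval in the real Banach lattice `X`:
`inf_{|c| = 1} ‖f - c g‖ ≤ C ‖|f| - |g|‖` for all `f, g ∈ E`. The infimum is over the nonempty set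
of real scalars of modulus one, and it is bounded below by `0`. The modulus `|f| = f ⊔ -f` is the
lattice one; in `C(K, ℝ)` it is the pointwise absolute value. -/
def DoesStablePhaseRetrievalWith {X : Type*} [NormedAddCommGroup X] [NormedSpace ℝ X] [Lattice X]
    [HasSolidNorm X] [IsOrderedAddMonoid X] (E : Submodule ℝ X) (C : ℝ) : Prop :=
  ∀ f ∈ E, ∀ g ∈ E, (⨅ c : {c : ℝ // |c| = 1}, ‖f - (c : ℝ) • g‖) ≤ C * ‖|f| - |g|‖

/-- `E` does stable phase retrieval (SPR): it does `C`-stable phase retrieval for some constant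
`C > 0`. -/
def DoesSPR {X : Type*} [NormedAddCommGroup X] [NormedSpace ℝ X] [Lattice X]
    [HasSolidNorm X] [IsOrderedAddMonoid X] (E : Submodule ℝ X) : Prop :=
  ∃ C : ℝ, 0 < C ∧ DoesStablePhaseRetrievalWith E C

/-- The Cantor-Bendixson derivative of a topological space: the set of its accumulation points,
that is, of its non-isolated points. -/
def cantorBendixsonDerivative (K : Type*) [TopologicalSpace K] : Set K :=
  derivedSet (Set.univ : Set K)

/-- The derivative consists exactly of the non-isolated points. -/
theorem mem_cantorBendixsonDerivative_iff {K : Type*} [TopologicalSpace K] (t : K) :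
    t ∈ cantorBendixsonDerivative K ↔ ¬ IsOpen ({t} : Set K) := by
  rw [cantorBendixsonDerivative, mem_derivedSet, accPt_principal_iff_nhdsWithin,
    isOpen_singleton_iff_punctured_nhds, ← Set.compl_eq_univ_sdiff, Filter.neBot_iff]

end Definitions

/-! Pointwise `||f| - |g||` is the minimum of `|f - g|` and `|f + g|`. So SPR fails exactly when two
normalized elements of `E` can have arbitrarily small pointwise minimum of moduli. If `K'` is
finite, some normalized `u` in `E` vanishes on `K'`, so it is small off a finite set, and some
normalized `v` in `E` vanishes on that set. If `K'` is infinite, `exists_seq_coordinates_and_sums`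
yields a copy of `c₀` in which evaluations at points of `K` include all `a n` and all `a n + a m`.
The sums stop two sequences with separated peaks from looking almost disjoint. -/

theorem AccPt.exists_seq_pairwise_disjoint_isOpen {X : Type*} [TopologicalSpace X] [T2Space X]
    {p : X} {A : Set X} (hp : AccPt p (Filter.principal A)) :
    ∃ (x : ℕ → X) (U : ℕ → Set X), (∀ n, x n ∈ A) ∧ (∀ n, x n ∈ U n) ∧ (∀ n, IsOpen (U n)) ∧
      (∀ n, p ∉ U n) ∧ Pairwise (Function.onFun Disjoint U) := by
  have : Std.Symm fun q r : X × Set X => Disjoint q.2 r.2 := ⟨fun _ _ h => h.symm⟩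
  obtain ⟨f, hf, hd⟩ := exists_seq_of_forall_finset_exists'
    (fun q : X × Set X => q.1 ∈ A ∧ q.1 ∈ q.2 ∧ IsOpen q.2 ∧ q.2ᶜ ∈ 𝓝 p)
    -- Each chosen set misses a neighbourhood of `p`, so there is always room for the next one
    -- closer to `p`.
    (fun q r => Disjoint q.2 r.2) (h := by
      intro s hs
      have hN : (⋂ q ∈ s, q.2ᶜ) ∈ 𝓝 p :=
        (Filter.biInter_finset_mem s).2 fun q hq => (hs q hq).2.2.2
      obtain ⟨y, ⟨hyN, hyA⟩, hyp⟩ := accPt_iff_nhds.1 hp _ (interior_mem_nhds.2 hN)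
      obtain ⟨u, v, hu, hv, hyu, hpv, huv⟩ := t2_separation hyp
      refine ⟨(y, u ∩ interior (⋂ q ∈ s, q.2ᶜ)), ⟨hyA, ⟨hyu, hyN⟩, hu.inter isOpen_interior,
        Filter.mem_of_superset (hv.mem_nhds hpv) fun z hz hz' =>
          Set.disjoint_left.1 huv hz'.1 hz⟩, fun q hq => Set.disjoint_left.2 fun z hz hz' => ?_⟩
      exact Set.mem_iInter₂.1 (interior_subset hz'.2) q hq hz)
  exact ⟨fun n => (f n).1, fun n => (f n).2, fun n => (hf n).1, fun n => (hf n).2.1,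
    fun n => (hf n).2.2.1, fun n hn => mem_of_mem_nhds (hf n).2.2.2 hn, hd⟩

/-- The plateau `W` leaves room for further points near `x` at which `b` is still exactly `1`. -/
theorem exists_continuousMap_eq_one_near {X : Type*} [TopologicalSpace X] [NormalSpace X]
    [T1Space X] {x : X} {U : Set X} (hU : IsOpen U) (hx : x ∈ U) :
    ∃ (W : Set X) (b : C(X, ℝ)), IsOpen W ∧ x ∈ W ∧ W ⊆ U ∧ (∀ y ∈ W, b y = 1) ∧
      (∀ y ∉ U, b y = 0) ∧ ∀ y, b y ∈ Set.Icc (0 : ℝ) 1 := by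
  obtain ⟨W, hW, hxW, hWU⟩ := normal_exists_closure_subset (isClosed_singleton (x := x)) hU
    (Set.singleton_subset_iff.2 hx)
  obtain ⟨b, h0, h1, hb⟩ := exists_continuous_zero_one_of_isClosed hU.isClosed_compl
    (isClosed_closure (s := W)) (Set.disjoint_left.2 fun y hy hy' => hy (hWU hy'))
  exact ⟨W, b, hW, hxW rfl, subset_closure.trans hWU, fun y hy => h1 (subset_closure hy),
    fun y hy => h0 hy, hb⟩

theorem Finset.sum_le_one_of_pairwise_disjoint_support {ι X : Type*} {h : ι → X → ℝ}
    {V : ι → Set X} (hV : Pairwise (Function.onFun Disjoint V)) (h0 : ∀ i, ∀ y ∉ V i, h i y = 0)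
    (h1 : ∀ i y, h i y ≤ 1) (S : Finset ι) (y : X) : ∑ i ∈ S, h i y ≤ 1 := by
  by_cases hy : ∃ i ∈ S, y ∈ V i
  · obtain ⟨i, hi, hyi⟩ := hy
    rw [Finset.sum_eq_single_of_mem i hi fun j _ hji => h0 j y fun hyj =>
      Set.disjoint_left.1 (hV hji) hyj hyi]
    exact h1 i y
  · push Not at hy
    rw [Finset.sum_eq_zero fun i hi => h0 i y (hy i hi)]
    exact zero_le_one

/-- If `K` has infinitely many accumulation points, there is a bounded sequence of nonnegative
functions on which point evaluations induce all coordinate functionals and all sums of two distinct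
coordinate functionals. -/
theorem exists_seq_coordinates_and_sums (K : Type*) [TopologicalSpace K] [CompactSpace K]
    [T2Space K] (hK : (cantorBendixsonDerivative K).Infinite) :
    ∃ (f : ℕ → C(K, ℝ)) (t : ℕ → K) (s : ℕ → ℕ → K),
      (∀ k n, f k (t n) = if k = n then 1 else 0) ∧
      (∀ k n m, n < m → f k (s n m) = (if k = n then 1 else 0) + if k = m then 1 else 0) ∧
      (∀ k y, 0 ≤ f k y) ∧ ∀ (S : Finset ℕ) (y : K), ∑ k ∈ S, f k y ≤ 2 := by
  obtain ⟨p, -, hp⟩ := hK.exists_accPt_of_subset_isCompact isCompact_univ (Set.subset_univ _)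
  obtain ⟨t, U, htA, htU, hU, -, hUd⟩ := hp.exists_seq_pairwise_disjoint_isOpen
  choose W b hW htW hWU hb1 hb0 hb using
    fun n => exists_continuousMap_eq_one_near (hU n) (htU n)
  have hacc : ∀ n, AccPt (t n) (Filter.principal (W n)) := fun n => by
    have h := (htA n).nhds_inter ((hW n).mem_nhds (htW n))
    rwa [Set.inter_univ] at h
  choose s V hsW hsV hV htV hVd using fun n => (hacc n).exists_seq_pairwise_disjoint_isOpen
  choose _ c _ hc1' hc2' hc1 hc0 hc using fun n m => exists_continuousMap_eq_one_near
    ((hV n m).inter (hU n)) ⟨hsV n m, hWU n (hsW n m)⟩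
  have hcs : ∀ n m, c n m (s n m) = 1 := fun n m => hc1 n m _ (hc1' n m)
  have hUU : ∀ {k n y}, y ∈ U n → k ≠ n → y ∉ U k := fun {k n y} hy hkn hy' =>
    Set.disjoint_left.1 (hUd hkn) hy' hy
  -- At `s n m` with `n < m`, `b n` contributes `1` to `f n` and the small bump `c n m` contributes
  -- `1` to `f m`; all other terms vanish.
  refine ⟨fun k => b k + ∑ j ∈ Finset.range k, c j k, t, s, ?_, ?_, ?_, ?_⟩
  · intro k n
    have h2 : ∑ j ∈ Finset.range k, c j k (t n) = 0 := Finset.sum_eq_zero fun j _ => by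
      refine hc0 j k _ fun h => ?_
      by_cases hjn : j = n
      · subst hjn; exact htV _ _ h.1
      · exact hUU (htU n) hjn h.2
    simp only [ContinuousMap.add_apply, ContinuousMap.sum_apply, h2, add_zero]
    split_ifs with h
    · subst h; exact hb1 _ _ (htW _)
    · exact hb0 _ _ (hUU (htU n) h)
  · intro k n m hnm
    have hsU := hWU n (hsW n m)
    have hcz : ∀ j, ¬ (j = n ∧ k = m) → c j k (s n m) = 0 := fun j hj => by
      refine hc0 j k _ fun h => ?_
      by_cases hjn : j = n
      · subst hjn
        exact Set.disjoint_left.1 (hVd j fun hkm => hj ⟨rfl, hkm⟩) h.1 (hsV j m)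
      · exact hUU hsU hjn h.2
    simp only [ContinuousMap.add_apply, ContinuousMap.sum_apply]
    congr 1
    · split_ifs with h
      · subst h; exact hb1 _ _ (hsW _ _)
      · exact hb0 _ _ (hUU hsU h)
    · split_ifs with h
      · subst h
        rw [Finset.sum_eq_single_of_mem n (Finset.mem_range.2 hnm)
          fun j _ hj => hcz j fun h => hj h.1, hcs]
      · exact Finset.sum_eq_zero fun j _ => hcz j fun h' => h h'.2
  · intro k y
    simp only [ContinuousMap.add_apply, ContinuousMap.sum_apply]
    exact add_nonneg (hb k y).1 (Finset.sum_nonneg fun j _ => (hc j k y).1)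
  · intro S y
    simp only [ContinuousMap.add_apply, ContinuousMap.sum_apply, Finset.sum_add_distrib]
    -- The `b k` have disjoint supports, and so do the `c j k`: each family contributes at most `1`.
    rw [← one_add_one_eq_two, Finset.sum_sigma']
    refine add_le_add (Finset.sum_le_one_of_pairwise_disjoint_support (h := fun i => b i) hUd hb0
      (fun i y => (hb i y).2) S y) ?_
    refine Finset.sum_le_one_of_pairwise_disjoint_support
      (h := fun (i : (_ : ℕ) × ℕ) y => c i.2 i.1 y) (V := fun i => V i.2 i.1 ∩ U i.2) ?_
      (fun i => hc0 i.2 i.1) (fun i y => (hc _ _ y).2) _ y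
    rintro ⟨m, n⟩ ⟨m', n'⟩ hne
    refine Set.disjoint_left.2 fun z hz hz' => ?_
    by_cases hn : n = n'
    · subst hn
      exact Set.disjoint_left.1 (hVd n fun h : m = m' => hne (by rw [h])) hz.1 hz'.1
    · exact hUU hz'.2 hn hz.2

theorem iInf_abs_eq_one_norm_sub_smul {X : Type*} [NormedAddCommGroup X] [NormedSpace ℝ X]
    (f g : X) : (⨅ c : {c : ℝ // |c| = 1}, ‖f - (c : ℝ) • g‖) = min ‖f - g‖ ‖f + g‖ := by
  have hbdd : BddBelow (Set.range fun c : {c : ℝ // |c| = 1} => ‖f - (c : ℝ) • g‖) :=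
    ⟨0, by rintro _ ⟨c, rfl⟩; exact norm_nonneg _⟩
  have : Nonempty {c : ℝ // |c| = 1} := ⟨⟨1, abs_one⟩⟩
  apply le_antisymm
  · refine le_min ?_ ?_
    · simpa using ciInf_le hbdd ⟨1, abs_one⟩
    · simpa using ciInf_le hbdd ⟨-1, by simp⟩
  · refine le_ciInf fun ⟨c, hc⟩ => ?_
    rcases eq_or_eq_neg_of_abs_eq hc with rfl | rfl
    · simp
    · simp

theorem abs_abs_sub_abs_eq_min (a b : ℝ) : |(|a| - |b|)| = min |a - b| |a + b| := by
  rcases le_total 0 a with ha | ha <;> rcases le_total 0 b with hb | hb <;>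
    simp only [abs_of_nonneg, abs_of_nonpos, ha, hb] <;> grind

theorem norm_abs_sub_abs_apply {K : Type*} [TopologicalSpace K] (f g : C(K, ℝ)) (y : K) :
    ‖(|f| - |g|) y‖ = min |(f - g) y| |(f + g) y| := by
  simp [abs_abs_sub_abs_eq_min]

/-- Both sides of the inequality are continuous in the pair `(f, g)`. -/
theorem DoesStablePhaseRetrievalWith.topologicalClosure {X : Type*} [NormedAddCommGroup X]
    [NormedSpace ℝ X] [Lattice X] [HasSolidNorm X] [IsOrderedAddMonoid X] {E : Submodule ℝ X}
    {C : ℝ} (h : DoesStablePhaseRetrievalWith E C) :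
    DoesStablePhaseRetrievalWith E.topologicalClosure C := by
  intro f hf g hg
  rw [iInf_abs_eq_one_norm_sub_smul]
  have habs : Continuous fun u : X => |u| := continuous_id.sup continuous_neg
  have hcl : IsClosed {q : X × X | min ‖q.1 - q.2‖ ‖q.1 + q.2‖ ≤ C * ‖|q.1| - |q.2|‖} :=
    isClosed_le (by fun_prop) (continuous_const.mul
      ((habs.comp continuous_fst).sub (habs.comp continuous_snd)).norm)
  have hmem : (f, g) ∈ closure ((E : Set X) ×ˢ (E : Set X)) := by
    rw [closure_prod_eq]; exact ⟨hf, hg⟩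
  refine closure_minimal (fun q hq => ?_) hcl hmem
  have hq' := h q.1 hq.1 q.2 hq.2
  rwa [iInf_abs_eq_one_norm_sub_smul] at hq'

theorem exists_isClosed_infiniteDimensional_doesSPR (K : Type*) [TopologicalSpace K]
    [CompactSpace K] [T2Space K] (hK : (cantorBendixsonDerivative K).Infinite) :
    ∃ E : Submodule ℝ C(K, ℝ),
      IsClosed (E : Set C(K, ℝ)) ∧ ¬ FiniteDimensional ℝ E ∧ DoesSPR E := by
  obtain ⟨f, t, s, ht, hs, h0, h2⟩ := exists_seq_coordinates_and_sums K hK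
  have hTy : ∀ (a : ℕ →₀ ℝ) (y : K),
      Finsupp.linearCombination ℝ f a y = ∑ k ∈ a.support, a k * f k y := fun a y => by
    simp [Finsupp.linearCombination_apply, Finsupp.sum, ContinuousMap.sum_apply]
  have hTt : ∀ (a : ℕ →₀ ℝ) n, Finsupp.linearCombination ℝ f a (t n) = a n := fun a n => by
    rw [hTy]; simp +contextual [ht, eq_comm]
  have hTs : ∀ (a : ℕ →₀ ℝ) n m, n < m →
      Finsupp.linearCombination ℝ f a (s n m) = a n + a m := fun a n m hnm => by
    rw [hTy]
    simp +contextual only [hs _ n m hnm, mul_add, Finset.sum_add_distrib]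
    congr 1 <;> simp +contextual [eq_comm]
  have hTnorm : ∀ (a : ℕ →₀ ℝ), ∃ n, ‖Finsupp.linearCombination ℝ f a‖ ≤ 2 * |a n| := fun a => by
    obtain ⟨n, hn⟩ : ∃ n, ∀ k ∈ a.support, |a k| ≤ |a n| := by
      rcases a.support.eq_empty_or_nonempty with h | h
      · exact ⟨0, by simp [h]⟩
      · obtain ⟨n, -, hn⟩ := a.support.exists_max_image (fun k => |a k|) h
        exact ⟨n, hn⟩
    refine ⟨n, (ContinuousMap.norm_le _ (by positivity)).2 fun y => ?_⟩
    rw [hTy]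
    calc ‖∑ k ∈ a.support, a k * f k y‖ ≤ ∑ k ∈ a.support, |a n| * f k y := by
          refine norm_sum_le_of_le _ fun k hk => ?_
          rw [norm_mul, Real.norm_eq_abs, Real.norm_eq_abs, abs_of_nonneg (h0 k y)]
          exact mul_le_mul_of_nonneg_right (hn k hk) (h0 k y)
      _ ≤ 2 * |a n| := by
          rw [← Finset.mul_sum, mul_comm]
          exact mul_le_mul_of_nonneg_right (h2 _ y) (abs_nonneg _)
  have hli : LinearIndependent ℝ f := fun a a' h => by
    ext n
    rw [← hTt a n, ← hTt a' n, h]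
  refine ⟨(Submodule.span ℝ (Set.range f)).topologicalClosure,
    Submodule.isClosed_topologicalClosure _, fun hfin => ?_, 4, by norm_num,
    DoesStablePhaseRetrievalWith.topologicalClosure ?_⟩
  · have hf : ∀ n, f n ∈ (Submodule.span ℝ (Set.range f)).topologicalClosure := fun n =>
      Submodule.le_topologicalClosure _ (Submodule.subset_span ⟨n, rfl⟩)
    have : LinearIndependent ℝ
        fun n => (⟨f n, hf n⟩ : (Submodule.span ℝ (Set.range f)).topologicalClosure) :=
      LinearIndependent.of_comp (Submodule.subtype _) hli
    have : Finite ℕ := this.finite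
    exact not_finite ℕ
  · intro u hu v hv
    rw [iInf_abs_eq_one_norm_sub_smul]
    obtain ⟨a, ha⟩ := Finsupp.mem_span_range_iff_exists_finsupp.1 (Submodule.sub_mem _ hu hv)
    obtain ⟨a', ha'⟩ := Finsupp.mem_span_range_iff_exists_finsupp.1 (Submodule.add_mem _ hu hv)
    rw [← Finsupp.linearCombination_apply] at ha ha'
    have hD := fun y => (norm_abs_sub_abs_apply u v y).symm.trans_le ((|u| - |v|).norm_coe_le_norm y)
    rw [← ha, ← ha'] at hD ⊢
    obtain ⟨n, hn⟩ := hTnorm a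
    obtain ⟨m, hm⟩ := hTnorm a'
    have h1 := hD (t n)
    have h2 := hD (t m)
    rw [hTt, hTt] at h1 h2
    have h3 : n ≠ m → min |a n + a m| |a' n + a' m| ≤ ‖|u| - |v|‖ := fun hnm => by
      rcases lt_or_gt_of_ne hnm with h | h
      · simpa [hTs _ _ _ h] using hD (s n m)
      · simpa [hTs _ _ _ h, add_comm] using hD (s m n)
    generalize ‖|u| - |v|‖ = D at h1 h2 h3 ⊢
    -- If both exceeded `2 * D`, then `h1` and `h2` would give `|a' n| ≤ D` and `|a m| ≤ D`. For `n
    -- ≠ m` both sums in `h3` would then exceed `D`.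
    have hmain : min |a n| |a' m| ≤ 2 * D := by
      by_cases hnm : n = m
      · subst hnm
        have : 0 ≤ min |a n| |a' n| := by positivity
        linarith
      · have h3 := h3 hnm
        have e1 : |a n| ≤ |a n + a m| + |a m| := by simpa using abs_sub (a n + a m) (a m)
        have e2 : |a' m| ≤ |a' n + a' m| + |a' n| := by
          simpa using abs_sub (a' n + a' m) (a' n)
        have := abs_nonneg (a m)
        have := abs_nonneg (a' n)
        have := abs_nonneg (a n)
        grind
    grind

theorem not_doesSPR_of_finite_cantorBendixsonDerivative {K : Type*} [TopologicalSpace K]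
    [CompactSpace K] (hK : (cantorBendixsonDerivative K).Finite)
    {E : Submodule ℝ C(K, ℝ)} (hE : ¬ FiniteDimensional ℝ E) : ¬ DoesSPR E := by
  rintro ⟨C, hC, h⟩
  have hvanish : ∀ F : Set K, F.Finite → ∃ u ∈ E, ‖u‖ = 1 ∧ ∀ y ∈ F, u y = 0 := by
    intro F hF
    have := hF.to_subtype
    let L : E →ₗ[ℝ] (F → ℝ) :=
      { toFun := fun u y => u.1 y
        map_add' := fun _ _ => rfl
        map_smul' := fun _ _ => rfl }
    have hL : ¬ Function.Injective L := fun hinj => hE (FiniteDimensional.of_injective L hinj)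
    rw [← LinearMap.ker_eq_bot, Submodule.eq_bot_iff] at hL
    push Not at hL
    obtain ⟨u, hu, hu0⟩ := hL
    have hu0' : (u : C(K, ℝ)) ≠ 0 := fun h => hu0 (Subtype.ext h)
    refine ⟨‖(u : C(K, ℝ))‖⁻¹ • (u : C(K, ℝ)), E.smul_mem _ u.2, ?_, fun y hy => ?_⟩
    · rw [norm_smul, norm_inv, norm_norm, inv_mul_cancel₀ (norm_ne_zero_iff.2 hu0')]
    · have : (u : C(K, ℝ)) y = 0 := congrFun (LinearMap.mem_ker.1 hu) ⟨y, hy⟩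
      simp [this]
  obtain ⟨u, huE, hu1, hu0⟩ := hvanish _ hK
  obtain ⟨ε, hε, hCε⟩ : ∃ ε : ℝ, 0 < ε ∧ C * ε < 1 := by
    refine ⟨(2 * C)⁻¹, by positivity, ?_⟩
    field_simp
    norm_num
  have hF : {y : K | ε ≤ |u y|}.Finite := by
    by_contra hinf
    have hcl : IsClosed {y : K | ε ≤ |u y|} := isClosed_le continuous_const (by fun_prop)
    obtain ⟨p, hp, hacc⟩ := Set.Infinite.exists_accPt_of_subset_isCompact hinf hcl.isCompact
      subset_rfl
    -- An accumulation point of the set lies in `K'`, where `u` vanishes.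
    have hp0 := hu0 p (hacc.mono (Filter.principal_mono.2 (Set.subset_univ _)))
    simp only [Set.mem_ofPred_eq, hp0, abs_zero] at hp
    linarith
  obtain ⟨v, hvE, hv1, hv0⟩ := hvanish _ hF
  -- This pair has difference `u` and sum `v`.
  have hsum := h ((2 : ℝ)⁻¹ • (u + v)) (E.smul_mem _ (E.add_mem huE hvE))
    ((2 : ℝ)⁻¹ • (v - u)) (E.smul_mem _ (E.sub_mem hvE huE))
  have e1 : (2 : ℝ)⁻¹ • (u + v) - (2 : ℝ)⁻¹ • (v - u) = u := by module
  have e2 : (2 : ℝ)⁻¹ • (u + v) + (2 : ℝ)⁻¹ • (v - u) = v := by module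
  have hsmall : ‖|(2 : ℝ)⁻¹ • (u + v)| - |(2 : ℝ)⁻¹ • (v - u)|‖ ≤ ε := by
    refine (ContinuousMap.norm_le _ hε.le).2 fun y => ?_
    rw [norm_abs_sub_abs_apply, e1, e2]
    by_cases hyF : ε ≤ |u y|
    · rw [hv0 y hyF, abs_zero]
      exact (min_le_right _ _).trans hε.le
    · exact (min_le_left _ _).trans (not_le.1 hyF).le
  rw [iInf_abs_eq_one_norm_sub_smul, e1, e2, hu1, hv1, min_self] at hsum
  linarith [mul_le_mul_of_nonneg_left hsmall hC.le]

theorem theorem6p1 (K : Type*) [TopologicalSpace K] [CompactSpace K] [T2Space K] :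
    (∃ E : Submodule ℝ C(K, ℝ),
        IsClosed (E : Set C(K, ℝ)) ∧ ¬ FiniteDimensional ℝ E ∧ DoesSPR E) ↔
      (cantorBendixsonDerivative K).Infinite := by
  refine ⟨?_, exists_isClosed_infiniteDimensional_doesSPR K⟩
  rintro ⟨E, -, hE, hSPR⟩ hfin
  exact not_doesSPR_of_finite_cantorBendixsonDerivative hfin hE hSPR
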